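/- Let $N\ge 1$, let $\Delta^N=\{w\in\mathbb R_{\ge 0}^N:\sum_i w_i=1\}$, and let $b\in\Delta^N$ have strictly positive entries. For $w,u\in\Delta^N$ let $D_{\mathrm{KL}}(w\|u)=\sum_i w_i\log(w_i/u_i)\in[0,\infty]$, with $0\log(0/u_i)=0$ and value $+\infty$ if $w_i>0=u_i$ for some $i$. For a closed convex set $C\subseteq\mathbb R^N$, the KL projection $\Pi^{\mathrm{KL}}_C(u)$ is the minimizer of $D_{\mathrm{KL}}(w\|u)$ over $w\in C\cap\Delta^N$ (with finite minimal value). Write $\mathrm{normalize}(v)=v/\sum_i v_i$, and let $\odot,\oslash$ be the entrywise product and quotient. (i) Let $K\ge 1$, $X\in\mathbb R^{N\times K}$ with columns $a_1,\dots,a_K$, and $t\in\mathbb R^K$, and suppose that some $w\in\Delta^N$ satisfies $X^\top w=t$. Then $D_{\mathrm{KL}}(\cdot\|b)$ has a unique minimizer $w^\star$ over $\{w\in\Delta^N: X^\top w=t\}$. The cyclic one-dimensional KL projections $w^{0}=b$, $w^{n+1}=\Pi^{\mathrm{KL}}_{\{w:\,a_k^\top w=t_k\}}(w^{n})$, with $k=(n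 \bmod K)+1$, are well defined (each projection exists and is unique), and $w^{n}\to w^\star$. Likewise, $w^n\to w^\star$ for every sequence with $w^0=b$ and $w^{n+1}=\mathrm{normalize}(w^n\odot e^{\alpha_n a_k})$, where $k=(n\bmod K)+1$ and $\alpha_n\in\mathbb R$ is such that $a_k^\top w^{n+1}=t_k$. (ii) Let $J\ge 1$ and let $C_1,\dots,C_J\subseteq\mathbb R^N$ be closed convex sets with $\Delta^N\cap\bigcap_j C_j\ne\emptyset$. Suppose that either every $C_j$ is of the form $\{w:a^\top w=\tau\}$ or $\{w:a^\top w\le\tau\}$ with $a\in\mathbb R^N$, $\tau\in\mathbb R$, or $\Delta^N\cap\bigcap_j C_j$ contains a point with strictly positive entries. Start with $w=b$ and $q_1=\dots=q_J=\mathbf 1$, and let $j$ run cyclically through $1,\dots,J$; in each step put $z=\Pi^{\mathrm{KL}}_{C_j}(\mathrm{normalize}(w\odot q_j))$, then replace $q_j$ by $(w\odot q_j)\oslash z$ and $w$ by $z$ (entries of the quotient at which $z_i=0$ are set to $0$; they do not influence the later iterates $w$). Then $b$ has a unique KL projection onto $\bigcap_j C_j$, all steps of this Bregman-Dykstra scheme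 are well defined (each projection exists and is unique), and the iterates $w$ converge to $\Pi^{\mathrm{KL}}_{\bigcap_j C_j}(b)$. -/

import Mathlib

open Filter Topology

noncomputable section

/-- The Kullback-Leibler divergence `∑ i, w i * log (w i / u i)` of nonnegative vectors, with the
usual conventions `0 * log (0 / u) = 0` and `w * log (w / 0) = ∞` for `w > 0`. -/
def klDist {N : ℕ} (w u : Fin N → ℝ) : EReal :=
  open Classical in
  if ∀ i, u i = 0 → w i = 0 then ((∑ i, w i * Real.log (w i / u i) : ℝ) : EReal) else ⊤

/-- `p` minimizes `w ↦ KL(w ‖ u)` over the points of `C` in the probability simplex, with a finite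
minimal value; that is, `p` is the KL projection of `u` onto `C`. -/
def IsKLProj {N : ℕ} (C : Set (Fin N → ℝ)) (u p : Fin N → ℝ) : Prop :=
  p ∈ C ∩ stdSimplex ℝ (Fin N) ∧ klDist p u ≠ ⊤ ∧
    ∀ w ∈ C ∩ stdSimplex ℝ (Fin N), klDist p u ≤ klDist w u

/-- `v / (𝟏ᵀ v)`. -/
def normalizeVec {N : ℕ} (v : Fin N → ℝ) : Fin N → ℝ := fun i => v i / ∑ l, v l

/-- The hyperplane `aᵀ w = τ`. -/
def linHyperplane {N : ℕ} (a : Fin N → ℝ) (τ : ℝ) : Set (Fin N → ℝ) := {w | a ⬝ᵥ w = τ}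

/-- The half-space `aᵀ w ≤ τ`. -/
def linHalfspace {N : ℕ} (a : Fin N → ℝ) (τ : ℝ) : Set (Fin N → ℝ) := {w | a ⬝ᵥ w ≤ τ}

/-- The sequence of all iterates of the cyclic KL projections, started at `b`, onto the
hyperplanes given by the columns of `X` and the entries of `t`.  Step `n` uses the constraint
with index `n` modulo `K`. -/
structure IsCyclicKLProj {N K : ℕ} [NeZero K] (X : Matrix (Fin N) (Fin K) ℝ) (t : Fin K → ℝ)
    (b : Fin N → ℝ) (w : ℕ → Fin N → ℝ) : Prop where
  w_zero : w 0 = b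
  w_succ : ∀ n, IsKLProj (linHyperplane (fun i => X i (Fin.ofNat K n)) (t (Fin.ofNat K n)))
    (w n) (w (n + 1))

/-- The same cycle with each step written as a one-dimensional solve: `w` is replaced by
`normalize (w ⊙ exp (α a))`, where `α` is a root of `aᵀ (normalize (w ⊙ exp (α a))) = τ`. -/
structure IsCyclicTilt {N K : ℕ} [NeZero K] (X : Matrix (Fin N) (Fin K) ℝ) (t : Fin K → ℝ)
    (b : Fin N → ℝ) (w : ℕ → Fin N → ℝ) : Prop where
  w_zero : w 0 = b
  w_succ : ∀ n, ∃ α : ℝ,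
    w (n + 1) = normalizeVec (fun i => w n i * Real.exp (α * X i (Fin.ofNat K n))) ∧
    w (n + 1) ∈ linHyperplane (fun i => X i (Fin.ofNat K n)) (t (Fin.ofNat K n))

/-- The iterates `w` and correction terms `q` of the Bregman-Dykstra scheme with the KL divergence,
started at `b`; step `n` uses the set with index `j = n` modulo `J`:
`z = Π_{C j} (normalize (w ⊙ q j))`, then `q j ← (w ⊙ q j) ⊘ z` and `w ← z`.
Entries of `q j` at which `z` vanishes get the value `0` here; they never influence the iterates,
since a zero entry of `w` stays zero. -/
structure IsBregmanDykstra {N J : ℕ} [NeZero J] (C : Fin J → Set (Fin N → ℝ))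
    (b : Fin N → ℝ) (w : ℕ → Fin N → ℝ) (q : ℕ → Fin J → Fin N → ℝ) : Prop where
  w_zero : w 0 = b
  q_zero : q 0 = fun _ _ => 1
  w_succ : ∀ n, IsKLProj (C (Fin.ofNat J n)) (normalizeVec (w n * q n (Fin.ofNat J n))) (w (n + 1))
  q_succ : ∀ n, q (n + 1) =
    Function.update (q n) (Fin.ofNat J n) (w n * q n (Fin.ofNat J n) / w (n + 1))

end

/-! The KL projection behaves like a Euclidean one. Minimality of `p` gives the variational
inequality `∑ (v - p) log (p / u) ≥ 0`, that is KL(v‖u) ≥ KL(v‖p) + KL(p‖u), for every `v` of the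
set in the simplex with finite divergence (`IsKLProj.sum_nonneg`). It also forces the support of `p`
to contain that of each such `v` (`IsKLProj.suppLE`), so feasible points keep finite divergence from
all iterates and every later projection exists.

Convergence is a primal-dual argument. Suppose KL(v‖w n) + c n ≤ KL(v‖b) for all feasible `v`, where
each step raises `c` by at least KL(w (n+1)‖w n). Then `c` is bounded, the squared step lengths are
summable by Pinsker, and cluster points are feasible. A feasible `y` whose KL(y‖b) is approached by
`c` is optimal and attracts the whole sequence (`tendsto_of_no_duality_gap`).

For hyperplanes, `c` is the accumulated step divergence and Pythagoras is an equality, so any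
cluster point closes the gap. For Dykstra, `c` is a dual value: log w + ∑ log q j = log b, each log
q j is normal to C j at the last iterate projected there, and the gap is the sum of the slacks in
these normality inequalities. For hyperplanes and half-spaces the slacks at a cluster point vanish
along the subsequence. If there is a positive feasible point, the iterates stay away from zero, the
log q j grow at most like the path length, and the resulting error is small infinitely often
(`frequently_sum_mul_sum_lt`). -/

/-! ### KL divergence on the simplex and Pinsker's inequality -/

/-- The real-valued sum `∑ i, w i * log (w i / u i)`. -/
noncomputable def klSum {N : ℕ} (w u : Fin N → ℝ) : ℝ := ∑ i, w i * Real.log (w i / u i)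

/-- The support of `w` is contained in the support of `u`. -/
def SuppLE {N : ℕ} (w u : Fin N → ℝ) : Prop := ∀ i, u i = 0 → w i = 0

theorem SuppLE.trans {N : ℕ} {w u v : Fin N → ℝ} (h : SuppLE w u) (h' : SuppLE u v) :
    SuppLE w v := fun i hi => h i (h' i hi)

theorem SuppLE.pos {N : ℕ} {w u : Fin N → ℝ} (h : SuppLE w u) (hu : ∀ i, 0 ≤ u i) {i : Fin N}
    (hi : 0 < w i) : 0 < u i :=
  lt_of_le_of_ne (hu i) fun h0 => hi.ne' (h i h0.symm)

theorem suppLE_of_pos {N : ℕ} {w u : Fin N → ℝ} (hu : ∀ i, 0 < u i) : SuppLE w u :=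
  fun i hi => absurd hi (hu i).ne'

theorem klDist_of_suppLE {N : ℕ} {w u : Fin N → ℝ} (h : SuppLE w u) :
    klDist w u = (klSum w u : EReal) := by
  unfold klDist
  exact if_pos h

theorem klDist_of_not_suppLE {N : ℕ} {w u : Fin N → ℝ} (h : ¬ SuppLE w u) : klDist w u = ⊤ := by
  unfold klDist
  exact if_neg h

theorem isKLProj_iff {N : ℕ} {C : Set (Fin N → ℝ)} {u p : Fin N → ℝ} :
    IsKLProj C u p ↔ p ∈ C ∧ p ∈ stdSimplex ℝ (Fin N) ∧ SuppLE p u ∧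
      ∀ w ∈ C, w ∈ stdSimplex ℝ (Fin N) → SuppLE w u → klSum p u ≤ klSum w u := by
  constructor
  · rintro ⟨⟨h1, h2⟩, h3, h4⟩
    have hs : SuppLE p u := by
      by_contra h
      exact h3 (klDist_of_not_suppLE h)
    refine ⟨h1, h2, hs, fun w hw hw' hwu => ?_⟩
    have := h4 w ⟨hw, hw'⟩
    rw [klDist_of_suppLE hs, klDist_of_suppLE hwu] at this
    exact EReal.coe_le_coe_iff.1 this
  · rintro ⟨h1, h2, hs, h4⟩
    refine ⟨⟨h1, h2⟩, ?_, fun w hw => ?_⟩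
    · rw [klDist_of_suppLE hs]
      exact EReal.coe_ne_top _
    · by_cases h : SuppLE w u
      · rw [klDist_of_suppLE hs, klDist_of_suppLE h]
        exact EReal.coe_le_coe_iff.2 (h4 w hw.1 hw.2 h)
      · rw [klDist_of_not_suppLE h]
        exact le_top

theorem continuous_klSum {N : ℕ} (u : Fin N → ℝ) : Continuous fun w => klSum w u := by
  refine continuous_finsetSum _ fun i _ => ?_
  -- Division by zero and `Real.log 0 = 0` make the term vanish identically when `u i = 0`.
  by_cases hu : u i = 0
  · simp [hu, continuous_const]
  · have h : (fun w : Fin N → ℝ => w i * Real.log (w i / u i)) =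
        fun w => u i * ((w i / u i) * Real.log (w i / u i)) := by
      funext w
      field_simp
    rw [h]
    have hc : Continuous fun w : Fin N → ℝ => w i / u i := by fun_prop
    exact continuous_const.mul (Real.continuous_mul_log.comp hc)

/-- Both sides are compared with the Hellinger term (√w - √u)²; the lower bound on the logarithm is
log s ≤ s - 1 at s = √u / √w. -/
theorem sq_sub_le_mul_log {w u : ℝ} (hw : 0 ≤ w) (hu : 0 ≤ u) (hw1 : w ≤ 1) (hu1 : u ≤ 1)
    (h : u = 0 → w = 0) : (w - u) ^ 2 ≤ 4 * (w * Real.log (w / u) - w + u) := by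
  have hsq : (w - u) ^ 2 ≤ 4 * (√w - √u) ^ 2 := by
    have e : w - u = (√w - √u) * (√w + √u) := by
      nlinarith [Real.sq_sqrt hw, Real.sq_sqrt hu]
    have h1 : √w ≤ 1 := Real.sqrt_le_one.2 hw1
    have h2 : √u ≤ 1 := Real.sqrt_le_one.2 hu1
    have h3 : (√w + √u) ^ 2 ≤ 2 ^ 2 := by
      have := Real.sqrt_nonneg w
      have := Real.sqrt_nonneg u
      gcongr
      linarith
    rw [e, mul_pow]
    nlinarith [sq_nonneg (√w - √u)]
  have hlog : (√w - √u) ^ 2 ≤ w * Real.log (w / u) - w + u := by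
    rcases hw.eq_or_lt with rfl | hw0
    · simp [Real.sq_sqrt hu]
    have hu0 : 0 < u := lt_of_le_of_ne hu fun h0 => hw0.ne' (h h0.symm)
    have hsw := Real.sqrt_pos.2 hw0
    have hsu := Real.sqrt_pos.2 hu0
    have e : Real.log (w / u) = -2 * Real.log (√u / √w) := by
      rw [Real.log_div hw0.ne' hu0.ne', Real.log_div hsu.ne' hsw.ne', Real.log_sqrt hw,
        Real.log_sqrt hu]
      ring
    have hl := Real.log_le_sub_one_of_pos (div_pos hsu hsw)
    have h1 : w * Real.log (√u / √w) ≤ √w * √u - w := by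
      have := mul_le_mul_of_nonneg_left hl hw
      have e2 : w * (√u / √w - 1) = √w * √u - w := by
        field_simp
        nlinarith [Real.sq_sqrt hw]
      linarith
    rw [e]
    nlinarith [Real.sq_sqrt hw, Real.sq_sqrt hu]
  linarith

theorem le_one_of_mem_stdSimplex {N : ℕ} {w : Fin N → ℝ} (hw : w ∈ stdSimplex ℝ (Fin N))
    (i : Fin N) : w i ≤ 1 :=
  hw.2 ▸ Finset.single_le_sum (fun j _ => hw.1 j) (Finset.mem_univ i)

/-- A form of Pinsker's inequality. -/
theorem sum_sq_sub_le_klSum {N : ℕ} {w u : Fin N → ℝ} (hw : w ∈ stdSimplex ℝ (Fin N))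
    (hu : u ∈ stdSimplex ℝ (Fin N)) (h : SuppLE w u) :
    ∑ i, (w i - u i) ^ 2 ≤ 4 * klSum w u := by
  calc ∑ i, (w i - u i) ^ 2 ≤ ∑ i, 4 * (w i * Real.log (w i / u i) - w i + u i) :=
        Finset.sum_le_sum fun i _ => sq_sub_le_mul_log (hw.1 i) (hu.1 i)
          (le_one_of_mem_stdSimplex hw i) (le_one_of_mem_stdSimplex hu i) (h i)
    _ = 4 * klSum w u := by
        rw [← Finset.mul_sum, Finset.sum_add_distrib, Finset.sum_sub_distrib, hw.2, hu.2, klSum]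
        ring

theorem klSum_nonneg {N : ℕ} {w u : Fin N → ℝ} (hw : w ∈ stdSimplex ℝ (Fin N))
    (hu : u ∈ stdSimplex ℝ (Fin N)) (h : SuppLE w u) : 0 ≤ klSum w u := by
  have h1 := sum_sq_sub_le_klSum hw hu h
  have h2 : 0 ≤ ∑ i, (w i - u i) ^ 2 := Finset.sum_nonneg fun i _ => sq_nonneg _
  linarith

theorem dist_sq_le_klSum {N : ℕ} {w u : Fin N → ℝ} (hw : w ∈ stdSimplex ℝ (Fin N))
    (hu : u ∈ stdSimplex ℝ (Fin N)) (h : SuppLE w u) : dist w u ^ 2 ≤ 4 * klSum w u := by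
  have h1 := sum_sq_sub_le_klSum hw hu h
  have h0 := klSum_nonneg hw hu h
  have h2 : dist w u ≤ √(4 * klSum w u) := by
    refine (dist_pi_le_iff (Real.sqrt_nonneg _)).2 fun i => ?_
    rw [Real.dist_eq]
    refine Real.abs_le_sqrt (le_trans ?_ h1)
    exact Finset.single_le_sum (f := fun i => (w i - u i) ^ 2) (fun j _ => sq_nonneg _)
      (Finset.mem_univ i)
  calc dist w u ^ 2 ≤ √(4 * klSum w u) ^ 2 := by gcongr
    _ = 4 * klSum w u := Real.sq_sqrt (by linarith)

theorem eq_of_klSum_nonpos {N : ℕ} {w u : Fin N → ℝ} (hw : w ∈ stdSimplex ℝ (Fin N))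
    (hu : u ∈ stdSimplex ℝ (Fin N)) (h : SuppLE w u) (h0 : klSum w u ≤ 0) : w = u := by
  have h1 := dist_sq_le_klSum hw hu h
  have h2 : dist w u ^ 2 = 0 := le_antisymm (by linarith) (sq_nonneg _)
  exact dist_eq_zero.1 (pow_eq_zero_iff two_ne_zero |>.1 h2)

/-- The last sum is linear in `v`, which turns first-order conditions at `p` into Pythagorean
relations. -/
theorem klSum_eq_add {N : ℕ} {v p u : Fin N → ℝ} (hvp : SuppLE v p) (hpu : SuppLE p u) :
    klSum v u = klSum v p + ∑ i, v i * Real.log (p i / u i) := by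
  unfold klSum
  rw [← Finset.sum_add_distrib]
  refine Finset.sum_congr rfl fun i _ => ?_
  by_cases hv : v i = 0
  · simp [hv]
  have hp : p i ≠ 0 := fun h => hv (hvp i h)
  have hu : u i ≠ 0 := fun h => hp (hpu i h)
  rw [Real.log_div hv hu, Real.log_div hv hp, Real.log_div hp hu]
  ring

/-! ### Existence, uniqueness and variational inequality of the KL projection -/

theorem exists_isKLProj {N : ℕ} {C : Set (Fin N → ℝ)} (hC : IsClosed C) {u v : Fin N → ℝ}
    (hvC : v ∈ C) (hv : v ∈ stdSimplex ℝ (Fin N)) (hvu : SuppLE v u) : ∃ p, IsKLProj C u p := by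
  have hcl : IsClosed {w : Fin N → ℝ | SuppLE w u} := by
    have : {w : Fin N → ℝ | SuppLE w u} = ⋂ i, ⋂ _ : u i = 0, {w | w i = 0} := by
      ext w
      simp [SuppLE]
    rw [this]
    exact isClosed_iInter fun i => isClosed_iInter fun _ =>
      isClosed_eq (continuous_apply i) continuous_const
  have hcomp : IsCompact (stdSimplex ℝ (Fin N) ∩ (C ∩ {w | SuppLE w u})) :=
    (isCompact_stdSimplex ℝ (Fin N)).inter_right (hC.inter hcl)
  obtain ⟨p, hp, hmin⟩ := hcomp.exists_isMinOn ⟨v, hv, hvC, hvu⟩ (continuous_klSum u).continuousOn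
  exact ⟨p, isKLProj_iff.2 ⟨hp.2.1, hp.1, hp.2.2, fun w hw hw' hwu => hmin ⟨hw', hw, hwu⟩⟩⟩

section Projection

variable {N : ℕ} {C : Set (Fin N → ℝ)} {u p v : Fin N → ℝ}

/-- A derivative-free optimality condition: for r = p + ε(v - p), expanding KL(p‖u) through `r` in
KL(p‖u) ≤ KL(r‖u) shows that ε times the sum is at least KL(p‖r) ≥ 0. -/
theorem sum_sub_mul_log_segment_nonneg (hC : Convex ℝ C) (hp : IsKLProj C u p)
    (hvC : v ∈ C) (hv : v ∈ stdSimplex ℝ (Fin N)) (hvu : SuppLE v u) {ε : ℝ} (h0 : 0 < ε)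
    (h1 : ε < 1) : 0 ≤ ∑ i, (v i - p i) * Real.log ((p i + ε * (v i - p i)) / u i) := by
  obtain ⟨hpC, hpΔ, hpu, hmin⟩ := isKLProj_iff.1 hp
  set r : Fin N → ℝ := fun i => p i + ε * (v i - p i) with hr
  have hrr : r = (1 - ε) • p + ε • v := by
    funext i
    simp only [hr, Pi.add_apply, Pi.smul_apply, smul_eq_mul]
    ring
  have hrC : r ∈ C := hrr ▸ hC hpC hvC (by linarith) h0.le (by ring)
  have hrΔ : r ∈ stdSimplex ℝ (Fin N) :=
    hrr ▸ convex_stdSimplex ℝ (Fin N) hpΔ hv (by linarith) h0.le (by ring)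
  have hru : SuppLE r u := fun i hi => by simp [hr, hpu i hi, hvu i hi]
  have hpr : SuppLE p r := fun i hi => by
    have hp0 := hpΔ.1 i
    have hv0 := hv.1 i
    have e : (1 - ε) * p i + ε * v i = 0 := by rw [← hi]; simp only [hr]; ring
    have h2 : 0 ≤ ε * v i := by positivity
    have h3 : (1 - ε) * p i = 0 := le_antisymm (by linarith) (mul_nonneg (by linarith) hp0)
    exact (mul_eq_zero.1 h3).resolve_left (by linarith)
  have hle := hmin r hrC hrΔ hru
  have e1 := klSum_eq_add hpr hru
  have e2 := klSum_nonneg hpΔ hrΔ hpr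
  have e3 : klSum r u = ∑ i, p i * Real.log (r i / u i) +
      ε * ∑ i, (v i - p i) * Real.log (r i / u i) := by
    rw [klSum, Finset.mul_sum, ← Finset.sum_add_distrib]
    refine Finset.sum_congr rfl fun i _ => ?_
    simp only [hr]
    ring
  exact nonneg_of_mul_nonneg_right (by linarith) h0

theorem mul_log_segment_le {p v u ε : ℝ} (hp : 0 ≤ p) (hv : 0 ≤ v) (hu : 0 ≤ u) (h0 : 0 < ε)
    (h1 : ε ≤ 1 / 2) : (v - p) * Real.log ((p + ε * (v - p)) / u) ≤
      (v - p) * Real.log ((p + 1 / 2 * (v - p)) / u) := by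
  rcases hu.eq_or_lt with rfl | hu
  · simp
  rcases lt_trichotomy v p with h | h | h
  · have a1 : 0 < p + 1 / 2 * (v - p) := by linarith
    have a2 : p + 1 / 2 * (v - p) ≤ p + ε * (v - p) := by nlinarith
    exact mul_le_mul_of_nonpos_left (Real.log_le_log (by positivity) (by gcongr)) (by linarith)
  · simp [h]
  · have a1 : 0 < p + ε * (v - p) := by nlinarith
    have a2 : p + ε * (v - p) ≤ p + 1 / 2 * (v - p) := by nlinarith
    exact mul_le_mul_of_nonneg_left (Real.log_le_log (by positivity) (by gcongr)) (by linarith)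

/-- The KL projection has the largest support among the points of finite divergence. -/
theorem IsKLProj.suppLE (hC : Convex ℝ C) (hu : ∀ i, 0 ≤ u i) (hp : IsKLProj C u p)
    (hvC : v ∈ C) (hv : v ∈ stdSimplex ℝ (Fin N)) (hvu : SuppLE v u) : SuppLE v p := by
  obtain ⟨hpC, hpΔ, hpu, hmin⟩ := isKLProj_iff.1 hp
  intro k hk
  by_contra hvk
  have hvk0 : 0 < v k := lt_of_le_of_ne (hv.1 k) (Ne.symm hvk)
  have huk : 0 < u k := hvu.pos hu hvk0
  set M : ℝ := ∑ i ∈ Finset.univ.erase k, (v i - p i) * Real.log ((p i + 1 / 2 * (v i - p i)) / u i)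
  -- If p k = 0 < v k, the term at `k` tends to -∞ as ε → 0, while the others stay below `M` by
  -- monotonicity in ε; this contradicts the segment inequality.
  have hbound : ∀ᶠ ε : ℝ in 𝓝[>] 0, 0 ≤ v k * Real.log (ε * (v k / u k)) + M := by
    filter_upwards [Ioc_mem_nhdsGT (show (0 : ℝ) < 1 / 2 by norm_num)] with ε hε
    refine (sum_sub_mul_log_segment_nonneg hC hp hvC hv hvu hε.1 (by linarith [hε.2])).trans ?_
    rw [← Finset.add_sum_erase _ _ (Finset.mem_univ k), hk]
    refine add_le_add (le_of_eq ?_) (Finset.sum_le_sum fun i _ =>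
      mul_log_segment_le (hpΔ.1 i) (hv.1 i) (hu i) hε.1 hε.2)
    rw [sub_zero, zero_add, mul_div_assoc]
  have hlim : Tendsto (fun ε : ℝ => v k * Real.log (ε * (v k / u k)) + M) (𝓝[>] 0) atBot := by
    refine tendsto_atBot_add_const_right _ _ (Tendsto.const_mul_atBot hvk0 ?_)
    refine Real.tendsto_log_nhdsGT_zero.comp ?_
    refine tendsto_nhdsWithin_iff.2 ⟨?_, ?_⟩
    · have : Tendsto (fun ε : ℝ => ε * (v k / u k)) (𝓝 0) (𝓝 (0 * (v k / u k))) :=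
        tendsto_id.mul_const _
      rw [zero_mul] at this
      exact this.mono_left nhdsWithin_le_nhds
    · filter_upwards [self_mem_nhdsWithin] with ε hε
      exact mul_pos (Set.mem_Ioi.1 hε) (div_pos hvk0 huk)
  obtain ⟨ε, h1, h2⟩ := (hbound.and (hlim.eventually_lt_atBot 0)).exists
  linarith

/-- The variational inequality of the KL projection. -/
theorem IsKLProj.sum_nonneg (hC : Convex ℝ C) (hu : ∀ i, 0 ≤ u i) (hp : IsKLProj C u p)
    (hvC : v ∈ C) (hv : v ∈ stdSimplex ℝ (Fin N)) (hvu : SuppLE v u) :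
    0 ≤ ∑ i, (v i - p i) * Real.log (p i / u i) := by
  have hvp := hp.suppLE hC hu hvC hv hvu
  obtain ⟨hpC, hpΔ, hpu, hmin⟩ := isKLProj_iff.1 hp
  have hlim : Tendsto (fun ε : ℝ => ∑ i, (v i - p i) * Real.log ((p i + ε * (v i - p i)) / u i))
      (𝓝[>] 0) (𝓝 (∑ i, (v i - p i) * Real.log (p i / u i))) := by
    refine tendsto_finsetSum _ fun i _ => ?_
    by_cases hpi : p i = 0
    · simp [hpi, hvp i hpi]
    have hui : u i ≠ 0 := fun h => hpi (hpu i h)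
    have hc : ContinuousAt
        (fun ε : ℝ => (v i - p i) * Real.log ((p i + ε * (v i - p i)) / u i)) 0 := by
      refine continuousAt_const.mul (ContinuousAt.log (by fun_prop) ?_)
      simp [hpi, hui]
    have := hc.tendsto
    simp only [zero_mul, add_zero] at this
    exact this.mono_left nhdsWithin_le_nhds
  refine ge_of_tendsto hlim ?_
  filter_upwards [Ioo_mem_nhdsGT (zero_lt_one (α := ℝ))] with ε hε
  exact sum_sub_mul_log_segment_nonneg hC hp hvC hv hvu hε.1 hε.2

/-- The variational inequality at `p` and the minimality of `v` together give KL(v‖p) ≤ 0. -/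
theorem IsKLProj.eq (hC : Convex ℝ C) (hu : ∀ i, 0 ≤ u i) (hp : IsKLProj C u p)
    (hv : IsKLProj C u v) : v = p := by
  obtain ⟨hpC, hpΔ, hpu, hmin⟩ := isKLProj_iff.1 hp
  obtain ⟨hvC, hvΔ, hvu, hmin'⟩ := isKLProj_iff.1 hv
  have hvp := hp.suppLE hC hu hvC hvΔ hvu
  have h1 := hp.sum_nonneg hC hu hvC hvΔ hvu
  have h2 := hmin' p hpC hpΔ hpu
  rw [klSum_eq_add hvp hpu] at h2
  simp only [sub_mul, Finset.sum_sub_distrib] at h1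
  rw [klSum] at h2
  refine eq_of_klSum_nonpos hvΔ hpΔ hvp ?_
  rw [klSum] at h2 ⊢
  linarith

end Projection

/-! ### Normal vectors -/

/-- `s` is normal at `p` to the points of `C ∩ Δ` supported in the support of `p`. -/
def IsNormalAt {N : ℕ} (C : Set (Fin N → ℝ)) (p s : Fin N → ℝ) : Prop :=
  ∀ v ∈ C, v ∈ stdSimplex ℝ (Fin N) → SuppLE v p → ∑ i, (v i - p i) * s i ≤ 0

/-- If the segment from `v` to `p` can be prolonged slightly beyond `p` inside `C`, normality tested
at the prolonged point reverses the inequality. The support condition keeps that point in the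
simplex. -/
theorem IsNormalAt.sum_nonneg {N : ℕ} {C : Set (Fin N → ℝ)} {p s v : Fin N → ℝ}
    (h : IsNormalAt C p s) (hp : p ∈ stdSimplex ℝ (Fin N)) (hv : v ∈ stdSimplex ℝ (Fin N))
    (hvp : SuppLE v p) (hC : ∀ᶠ ε : ℝ in 𝓝[>] 0, (p - ε • (v - p)) ∈ C) :
    0 ≤ ∑ i, (v i - p i) * s i := by
  have hpos : ∀ᶠ ε : ℝ in 𝓝[>] 0, ∀ i, 0 ≤ (p - ε • (v - p)) i := by
    refine eventually_all.2 fun i => ?_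
    rcases (hp.1 i).eq_or_lt with hi | hi
    · exact Eventually.of_forall fun ε => by simp [← hi, hvp i hi.symm]
    · have hc : ContinuousAt (fun ε : ℝ => (p - ε • (v - p)) i) 0 := by
        simp only [Pi.sub_apply, Pi.smul_apply, smul_eq_mul]
        fun_prop
      have h0 : 0 < (p - (0 : ℝ) • (v - p)) i := by simpa using hi
      exact ((hc.eventually (lt_mem_nhds h0)).filter_mono nhdsWithin_le_nhds).mono
        fun ε hε => hε.le
  obtain ⟨ε, ⟨h1, h2⟩, hε⟩ := ((hC.and hpos).and self_mem_nhdsWithin).exists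
  have hε : 0 < ε := hε
  have hsum : ∑ i, (p - ε • (v - p)) i = 1 := by
    simp only [Pi.sub_apply, Pi.smul_apply, smul_eq_mul, Finset.sum_sub_distrib,
      ← Finset.mul_sum, hp.2, hv.2]
    ring
  have h3 := h _ h1 ⟨h2, hsum⟩ fun i hi => by simp [hi, hvp i hi]
  have e : ∑ i, ((p - ε • (v - p)) i - p i) * s i = -(ε * ∑ i, (v i - p i) * s i) := by
    rw [Finset.mul_sum, ← Finset.sum_neg_distrib]
    refine Finset.sum_congr rfl fun i _ => ?_
    simp only [Pi.sub_apply, Pi.smul_apply, smul_eq_mul]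
    ring
  rw [e] at h3
  exact nonneg_of_mul_nonneg_right (by linarith) hε

/-! ### Recursively defined and cyclic sequences -/

theorem existsUnique_seq {α : Type*} (P : ℕ → α → Prop) (R : ℕ → α → α → Prop) (a : α)
    (h0 : P 0 a) (hex : ∀ n x, P n x → ∃ y, R n x y)
    (huniq : ∀ n x y z, P n x → R n x y → R n x z → y = z)
    (hstep : ∀ n x y, P n x → R n x y → P (n + 1) y) :
    ∃! f : ℕ → α, f 0 = a ∧ ∀ n, R n (f n) (f (n + 1)) := by
  choose! g hg using hex
  let f : ℕ → α := fun n => Nat.rec a (fun n x => g n x) n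
  have hP : ∀ n, P n (f n) := fun n => by
    induction n with
    | zero => exact h0
    | succ n ih => exact hstep n _ _ ih (hg n _ ih)
  refine ⟨f, ⟨rfl, fun n => hg n _ (hP n)⟩, ?_⟩
  rintro f' ⟨h1, h2⟩
  funext n
  induction n with
  | zero => exact h1
  | succ n ih => exact huniq n (f n) _ _ (hP n) (ih ▸ h2 n) (hg n _ (hP n))

theorem tendsto_comp_of_bounded_shift {E : Type*} [PseudoMetricSpace E] {w : ℕ → E}
    (hδ : Tendsto (fun n => dist (w n) (w (n + 1))) atTop (𝓝 0)) {φ ψ : ℕ → ℕ}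
    (hφ : Tendsto φ atTop atTop) (L : ℕ) (h1 : ∀ k, φ k ≤ ψ k) (h2 : ∀ k, ψ k ≤ φ k + L) {x : E}
    (hx : Tendsto (fun k => w (φ k)) atTop (𝓝 x)) : Tendsto (fun k => w (ψ k)) atTop (𝓝 x) := by
  refine (tendsto_iff_of_dist ?_).1 hx
  have hs : Tendsto (fun n => ∑ i ∈ Finset.range L, dist (w (n + i)) (w (n + i + 1))) atTop
      (𝓝 0) := by
    have := tendsto_finsetSum (Finset.range L) (f := fun i n => dist (w (n + i)) (w (n + i + 1)))
      (a := fun _ => (0 : ℝ)) (x := atTop) fun i _ => hδ.comp (tendsto_add_atTop_nat i)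
    simpa using this
  refine squeeze_zero (fun _ => dist_nonneg) (fun k => ?_) (hs.comp hφ)
  obtain ⟨d, hd⟩ := Nat.exists_eq_add_of_le (h1 k)
  have hdL : d ≤ L := by have := h2 k; omega
  rw [hd]
  calc dist (w (φ k)) (w (φ k + d))
      ≤ ∑ i ∈ Finset.range d, dist (w (φ k + i)) (w (φ k + (i + 1))) :=
        dist_le_range_sum_dist (fun i => w (φ k + i)) d
    _ ≤ ∑ i ∈ Finset.range L, dist (w (φ k + i)) (w (φ k + i + 1)) :=
        Finset.sum_le_sum_of_subset_of_nonneg (Finset.range_mono hdL) fun _ _ _ => dist_nonneg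

theorem mem_of_tendsto_of_cyclic {E : Type*} [PseudoMetricSpace E] {J : ℕ} [NeZero J]
    {C : Fin J → Set E} (hC : ∀ j, IsClosed (C j)) {w : ℕ → E}
    (hw : ∀ n, w (n + 1) ∈ C (Fin.ofNat J n))
    (hδ : Tendsto (fun n => dist (w n) (w (n + 1))) atTop (𝓝 0)) {φ : ℕ → ℕ}
    (hφ : Tendsto φ atTop atTop) {x : E} (hx : Tendsto (fun k => w (φ k)) atTop (𝓝 x))
    (j : Fin J) : x ∈ C j := by
  have hJ : 0 < J := Nat.pos_of_neZero J
  -- The index is `n + 1` for the `n` congruent to `j` in the cycle after that of `φ k`, since step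
  -- `n` puts `w (n + 1)` into the set.
  have hlim : Tendsto (fun k => w (J * (φ k / J + 1) + j + 1)) atTop (𝓝 x) := by
    refine tendsto_comp_of_bounded_shift hδ hφ (2 * J + 1) (fun k => ?_) (fun k => ?_) hx
    · have := Nat.div_add_mod (φ k) J
      have := Nat.mod_lt (φ k) hJ
      rw [mul_add]
      omega
    · have := Nat.div_add_mod (φ k) J
      have := j.2
      rw [mul_add]
      omega
  refine (hC j).mem_of_tendsto hlim (Eventually.of_forall fun k => ?_)
  have e : Fin.ofNat J (J * (φ k / J + 1) + j) = j := by
    ext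
    simp [Nat.mod_eq_of_lt j.2]
  have := hw (J * (φ k / J + 1) + j)
  rwa [e] at this

/-! ### Convergence from a dual lower bound -/

section DualBound

variable {N : ℕ} {w : ℕ → Fin N → ℝ} {b : Fin N → ℝ} {c : ℕ → ℝ}

/-- The increments of the bounded sequence `c` dominate the step divergences, hence by Pinsker a
quarter of the squared steps; the sum telescopes. -/
theorem summable_dist_sq (hw : ∀ n, w n ∈ stdSimplex ℝ (Fin N))
    (hs : ∀ n, SuppLE (w (n + 1)) (w n)) (hc : ∀ n, c n + klSum (w (n + 1)) (w n) ≤ c (n + 1))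
    {B : ℝ} (hB : ∀ n, c n ≤ B) : Summable fun n => dist (w n) (w (n + 1)) ^ 2 := by
  refine summable_of_sum_range_le (c := 4 * (B - c 0)) (fun n => sq_nonneg _) fun n => ?_
  have h : ∑ i ∈ Finset.range n, dist (w i) (w (i + 1)) ^ 2 ≤ 4 * (c n - c 0) := by
    rw [← Finset.sum_range_sub, Finset.mul_sum]
    refine Finset.sum_le_sum fun i _ => ?_
    have := dist_sq_le_klSum (hw (i + 1)) (hw i) (hs i)
    rw [dist_comm]
    linarith [hc i]
  linarith [hB n]

theorem tendsto_dist_of_summable_sq (h : Summable fun n => dist (w n) (w (n + 1)) ^ 2) :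
    Tendsto (fun n => dist (w n) (w (n + 1))) atTop (𝓝 0) := by
  have := h.tendsto_atTop_zero.sqrt
  simpa [Real.sqrt_sq dist_nonneg] using this

/-- Iterates with a dual lower bound converge to a feasible point without duality gap, and that
point is optimal. -/
theorem tendsto_of_no_duality_gap {F : Set (Fin N → ℝ)} (hF : F ⊆ stdSimplex ℝ (Fin N))
    (hw : ∀ n, w n ∈ stdSimplex ℝ (Fin N)) (hc : Monotone c)
    (hs : ∀ v ∈ F, ∀ n, SuppLE v (w n)) (hv : ∀ v ∈ F, ∀ n, klSum v (w n) + c n ≤ klSum v b)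
    {x : Fin N → ℝ} (hx : x ∈ F) (hgap : ∀ ε > 0, ∃ n, klSum x b ≤ c n + ε) :
    Tendsto w atTop (𝓝 x) ∧ ∀ v ∈ F, klSum x b ≤ klSum v b := by
  constructor
  · rw [Metric.tendsto_atTop]
    intro ε hε
    -- From here on KL(x‖w m) ≤ ε²/8, so Pinsker with constant 4 gives squared distance at most
    -- ε²/2.
    obtain ⟨n, hn⟩ := hgap (ε ^ 2 / 8) (by positivity)
    refine ⟨n, fun m hm => ?_⟩
    have h1 := dist_sq_le_klSum (hF hx) (hw m) (hs x hx m)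
    have h2 := hv x hx m
    have h3 := hc hm
    rw [dist_comm]
    refine lt_of_pow_lt_pow_left₀ 2 hε.le ?_
    have : 0 < ε ^ 2 := by positivity
    linarith
  · intro v hvF
    refine le_of_forall_pos_le_add fun ε hε => ?_
    obtain ⟨n, hn⟩ := hgap ε hε
    have := klSum_nonneg (hF hvF) (hw n) (hs v hvF n)
    linarith [hv v hvF n]

theorem klSum_self {N : ℕ} (v : Fin N → ℝ) : klSum v v = 0 := by
  refine Finset.sum_eq_zero fun i _ => ?_
  by_cases h : v i = 0 <;> simp [h]

theorem tendsto_klSum_right {ι : Type*} {l : Filter ι} {y : ι → Fin N → ℝ} {x : Fin N → ℝ}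
    (h : Tendsto y l (𝓝 x)) : Tendsto (fun k => klSum x (y k)) l (𝓝 0) := by
  rw [← klSum_self x]
  refine tendsto_finsetSum _ fun i _ => ?_
  by_cases hi : x i = 0
  · simp [hi, tendsto_const_nhds]
  have hyi : Tendsto (fun k => y k i) l (𝓝 (x i)) := (tendsto_pi_nhds.1 h) i
  exact ((tendsto_const_nhds.div hyi hi).log (div_ne_zero hi hi)).const_mul _

end DualBound

/-! ### Projection onto a hyperplane -/

theorem convex_linHyperplane {N : ℕ} (a : Fin N → ℝ) (τ : ℝ) : Convex ℝ (linHyperplane a τ) := by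
  intro x hx y hy r s _ _ hrs
  simp only [linHyperplane, Set.mem_ofPred_eq, dotProduct_add, dotProduct_smul, smul_eq_mul] at *
  rw [hx, hy, ← add_mul, hrs, one_mul]

theorem isClosed_linHyperplane {N : ℕ} (a : Fin N → ℝ) (τ : ℝ) :
    IsClosed (linHyperplane a τ) :=
  isClosed_eq (by unfold dotProduct; fun_prop) continuous_const

theorem sub_smul_sub_mem_linHyperplane {N : ℕ} {a : Fin N → ℝ} {τ : ℝ} {p v : Fin N → ℝ}
    (hp : p ∈ linHyperplane a τ) (hv : v ∈ linHyperplane a τ) (ε : ℝ) :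
    p - ε • (v - p) ∈ linHyperplane a τ := by
  simp only [linHyperplane, Set.mem_ofPred_eq, dotProduct_sub, dotProduct_smul, smul_eq_mul] at *
  rw [hp, hv]
  ring

/-- The Pythagorean identity of the KL projection onto a hyperplane. -/
theorem IsKLProj.klSum_eq_add_klSum {N : ℕ} {a : Fin N → ℝ} {τ : ℝ} {u p v : Fin N → ℝ}
    (hu : ∀ i, 0 ≤ u i) (hp : IsKLProj (linHyperplane a τ) u p) (hvC : v ∈ linHyperplane a τ)
    (hv : v ∈ stdSimplex ℝ (Fin N)) (hvu : SuppLE v u) :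
    klSum v u = klSum v p + klSum p u := by
  have hC := convex_linHyperplane a τ
  have hvp := hp.suppLE hC hu hvC hv hvu
  have h1 := hp.sum_nonneg hC hu hvC hv hvu
  obtain ⟨hpC, hpΔ, hpu, -⟩ := isKLProj_iff.1 hp
  have hn : IsNormalAt (linHyperplane a τ) p fun i => -Real.log (p i / u i) := by
    intro y hy hyΔ hyp
    have := hp.sum_nonneg hC hu hy hyΔ (hyp.trans hpu)
    simpa using this
  -- A hyperplane contains the prolonged segment, so the variational inequality is an equality.
  have h2 := hn.sum_nonneg hpΔ hv hvp
    (Eventually.of_forall fun ε => sub_smul_sub_mem_linHyperplane hpC hvC ε)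
  rw [klSum_eq_add hvp hpu]
  simp only [sub_mul, mul_neg, Finset.sum_sub_distrib, Finset.sum_neg_distrib] at h1 h2
  unfold klSum
  linarith

/-- A normalized exponential tilt that lands on the hyperplane is the KL projection. -/
theorem isKLProj_normalizeVec_tilt {N : ℕ} {a : Fin N → ℝ} {τ α : ℝ} {u p : Fin N → ℝ}
    (hu : u ∈ stdSimplex ℝ (Fin N)) (hp : p = normalizeVec fun i => u i * Real.exp (α * a i))
    (hpC : p ∈ linHyperplane a τ) : IsKLProj (linHyperplane a τ) u p := by
  set Z := ∑ l, u l * Real.exp (α * a l) with hZ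
  have hZ0 : 0 < Z := by
    obtain ⟨i, hi⟩ : ∃ i, u i ≠ 0 := by
      by_contra! h
      have := hu.2
      simp [h] at this
    refine Finset.sum_pos' (fun l _ => mul_nonneg (hu.1 l) (Real.exp_pos _).le)
      ⟨i, Finset.mem_univ i, mul_pos (lt_of_le_of_ne (hu.1 i) hi.symm) (Real.exp_pos _)⟩
  have hpi : ∀ i, p i = u i * Real.exp (α * a i) / Z := fun i => by rw [hp]; rfl
  have hpΔ : p ∈ stdSimplex ℝ (Fin N) := by
    refine ⟨fun i => ?_, ?_⟩
    · rw [hpi]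
      exact div_nonneg (mul_nonneg (hu.1 i) (Real.exp_pos _).le) hZ0.le
    · simp only [hpi, ← Finset.sum_div, ← hZ, div_self hZ0.ne']
  have hpu : SuppLE p u := fun i hi => by simp [hpi, hi]
  have hup : SuppLE u p := fun i hi => by
    rw [hpi, div_eq_zero_iff, or_iff_left hZ0.ne', mul_eq_zero,
      or_iff_left (Real.exp_pos _).ne'] at hi
    exact hi
  -- On the support of `u`, log (p / u) is `α a` minus a constant, so its pairing with `v` is the
  -- same for all competitors and KL(v‖u) differs from KL(v‖p) by a constant.
  have key : ∀ v ∈ linHyperplane a τ, v ∈ stdSimplex ℝ (Fin N) → SuppLE v u →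
      ∑ i, v i * Real.log (p i / u i) = α * τ - Real.log Z := by
    intro v hvC hv hvu
    have e : ∀ i, v i * Real.log (p i / u i) = α * (a i * v i) - v i * Real.log Z := by
      intro i
      by_cases hvi : v i = 0
      · simp [hvi]
      have hui : u i ≠ 0 := fun h => hvi (hvu i h)
      have : p i / u i = Real.exp (α * a i) / Z := by
        rw [hpi]
        field_simp
      rw [this, Real.log_div (Real.exp_pos _).ne' hZ0.ne', Real.log_exp]
      ring
    have hvC : ∑ i, a i * v i = τ := hvC
    simp only [e, Finset.sum_sub_distrib, ← Finset.mul_sum, ← Finset.sum_mul, hv.2, hvC, one_mul]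
  refine isKLProj_iff.2 ⟨hpC, hpΔ, hpu, fun v hvC hv hvu => ?_⟩
  have hvp := hvu.trans hup
  rw [klSum_eq_add hvp hpu, key v hvC hv hvu]
  have : klSum p u = α * τ - Real.log Z := key p hpC hpΔ hpu
  rw [this]
  linarith [klSum_nonneg hv hpΔ hvp]

theorem setOf_mulVec_eq {N K : ℕ} (X : Matrix (Fin N) (Fin K) ℝ) (t : Fin K → ℝ) :
    {v | X.transpose.mulVec v = t} = ⋂ k, linHyperplane (fun i => X i k) (t k) := by
  ext v
  simp only [Set.mem_ofPred_eq, Set.mem_iInter, funext_iff]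
  rfl

/-! ### Cyclic projections onto hyperplanes -/

section Cyclic

variable {N K : ℕ} [NeZero K] {X : Matrix (Fin N) (Fin K) ℝ} {t : Fin K → ℝ} {b : Fin N → ℝ}

theorem IsCyclicTilt.isCyclicKLProj (hb : b ∈ stdSimplex ℝ (Fin N)) {w : ℕ → Fin N → ℝ}
    (h : IsCyclicTilt X t b w) : IsCyclicKLProj X t b w := by
  have hw : ∀ n, w n ∈ stdSimplex ℝ (Fin N) := fun n => by
    induction n with
    | zero => exact h.w_zero ▸ hb
    | succ n ih =>
      obtain ⟨α, h1, h2⟩ := h.w_succ n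
      exact (isKLProj_normalizeVec_tilt ih h1 h2).1.2
  refine ⟨h.w_zero, fun n => ?_⟩
  obtain ⟨α, h1, h2⟩ := h.w_succ n
  exact isKLProj_normalizeVec_tilt (hw n) h1 h2

theorem existsUnique_isCyclicKLProj (hb : b ∈ stdSimplex ℝ (Fin N)) (hbpos : ∀ i, 0 < b i)
    (hfeas : ∃ v ∈ stdSimplex ℝ (Fin N), X.transpose.mulVec v = t) :
    ∃! w : ℕ → Fin N → ℝ, IsCyclicKLProj X t b w := by
  obtain ⟨v, hv, hvt⟩ := hfeas
  have hvC : ∀ k, v ∈ linHyperplane (fun i => X i k) (t k) :=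
    Set.mem_iInter.1 (setOf_mulVec_eq X t ▸ hvt)
  have hiff : ∀ w, IsCyclicKLProj X t b w ↔ w 0 = b ∧ ∀ n, IsKLProj
      (linHyperplane (fun i => X i (Fin.ofNat K n)) (t (Fin.ofNat K n))) (w n) (w (n + 1)) :=
    fun w => ⟨fun h => ⟨h.1, h.2⟩, fun h => ⟨h.1, h.2⟩⟩
  simp only [hiff]
  refine existsUnique_seq (fun _ x => x ∈ stdSimplex ℝ (Fin N) ∧ SuppLE v x)
    (fun n x y => IsKLProj (linHyperplane (fun i => X i (Fin.ofNat K n)) (t (Fin.ofNat K n))) x y)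
    b ⟨hb, suppLE_of_pos hbpos⟩ ?_ ?_ ?_
  · rintro n x ⟨hx, hvx⟩
    exact exists_isKLProj (isClosed_linHyperplane _ _) (hvC _) hv hvx
  · rintro n x y z ⟨hx, hvx⟩ hy hz
    exact hz.eq (convex_linHyperplane _ _) hx.1 hy
  · rintro n x y ⟨hx, hvx⟩ hy
    exact ⟨hy.1.2, hy.suppLE (convex_linHyperplane _ _) hx.1 (hvC _) hv hvx⟩

theorem IsCyclicKLProj.tendsto (hb : b ∈ stdSimplex ℝ (Fin N)) (hbpos : ∀ i, 0 < b i)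
    {x : Fin N → ℝ} {w : ℕ → Fin N → ℝ} (hx : IsKLProj {v | X.transpose.mulVec v = t} b x)
    (h : IsCyclicKLProj X t b w) : Tendsto w atTop (𝓝 x) := by
  rw [setOf_mulVec_eq] at hx
  set C : Fin K → Set (Fin N → ℝ) := fun k => linHyperplane (fun i => X i k) (t k) with hC
  have hw : ∀ n, w n ∈ stdSimplex ℝ (Fin N) := fun n => by
    cases n with
    | zero => exact h.w_zero ▸ hb
    | succ n => exact (h.w_succ n).1.2
  set F : Set (Fin N → ℝ) := (⋂ k, C k) ∩ stdSimplex ℝ (Fin N) with hF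
  have hs : ∀ v ∈ F, ∀ n, SuppLE v (w n) := by
    intro v hv n
    induction n with
    | zero => exact h.w_zero ▸ suppLE_of_pos hbpos
    | succ n ih =>
      exact (h.w_succ n).suppLE (convex_linHyperplane _ _) (hw n).1
        (Set.mem_iInter.1 hv.1 _) hv.2 ih
  have hsw : ∀ n, SuppLE (w (n + 1)) (w n) := fun n => (isKLProj_iff.1 (h.w_succ n)).2.2.1
  set c : ℕ → ℝ := fun n => ∑ m ∈ Finset.range n, klSum (w (m + 1)) (w m) with hc
  have hstep : ∀ n, c n + klSum (w (n + 1)) (w n) = c (n + 1) := fun n =>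
    (Finset.sum_range_succ _ n).symm
  have hmono : Monotone c := monotone_nat_of_le_succ fun n => by
    linarith [hstep n, klSum_nonneg (hw (n + 1)) (hw n) (hsw n)]
  -- Pythagoras telescopes to an equality for every feasible `v`; applied at a cluster point `y`,
  -- where KL(y‖w (φ k)) → 0, it leaves no gap.
  have hpyth : ∀ v ∈ F, ∀ n, klSum v (w n) + c n = klSum v b := by
    intro v hv n
    induction n with
    | zero => simp [hc, h.w_zero]
    | succ n ih =>
      have := (h.w_succ n).klSum_eq_add_klSum (hw n).1 (Set.mem_iInter.1 hv.1 _) hv.2 (hs v hv n)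
      linarith [hstep n]
  have hxF : x ∈ F := hx.1
  have hδ := tendsto_dist_of_summable_sq (summable_dist_sq hw hsw (fun n => (hstep n).le)
    (B := klSum x b) fun n => by
      linarith [hpyth x hxF n, klSum_nonneg hxF.2 (hw n) (hs x hxF n)])
  obtain ⟨y, hyΔ, φ, hφ, hy⟩ := (isCompact_stdSimplex ℝ (Fin N)).tendsto_subseq hw
  have hyF : y ∈ F := ⟨Set.mem_iInter.2 (mem_of_tendsto_of_cyclic
    (fun k => isClosed_linHyperplane _ _) (fun n => (h.w_succ n).1.1) hδ hφ.tendsto_atTop hy), hyΔ⟩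
  have hkl := tendsto_klSum_right hy
  obtain ⟨h1, h2⟩ := tendsto_of_no_duality_gap (b := b) Set.inter_subset_right hw hmono hs
    (fun v hv n => (hpyth v hv n).le) hyF fun ε hε => by
      obtain ⟨k, hk⟩ := (hkl.eventually (gt_mem_nhds hε)).exists
      have hk : klSum y (w (φ k)) < ε := hk
      exact ⟨φ k, by linarith [hpyth y hyF (φ k)]⟩
  have hy' : IsKLProj (⋂ k, C k) b y := isKLProj_iff.2 ⟨hyF.1, hyF.2, suppLE_of_pos hbpos,
    fun v hv hv' _ => h2 v ⟨hv, hv'⟩⟩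
  rwa [hx.eq (convex_iInter fun k => convex_linHyperplane _ _) hb.1 hy'] at h1

end Cyclic

/-! ### Invariants and dual value of the Bregman-Dykstra scheme -/

section Dykstra

variable {N J : ℕ} {C : Fin J → Set (Fin N → ℝ)} {b w z : Fin N → ℝ}
  {q p : Fin J → Fin N → ℝ}

/-- The invariants of the Bregman-Dykstra scheme; `p j` is the last iterate obtained by a projection
onto `C j`. -/
structure DykstraInv (C : Fin J → Set (Fin N → ℝ)) (b w : Fin N → ℝ) (q p : Fin J → Fin N → ℝ) :
    Prop where
  mem : w ∈ stdSimplex ℝ (Fin N)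
  mem_last : ∀ j, p j ∈ stdSimplex ℝ (Fin N)
  supp : ∀ j, SuppLE w (p j)
  pos : ∀ j i, 0 < p j i → 0 < q j i
  feas : ∀ v ∈ stdSimplex ℝ (Fin N), (∀ j, v ∈ C j) → SuppLE v w
  normal : ∀ j, IsNormalAt (C j) (p j) fun i => Real.log (q j i)
  -- No normalizing constant appears, because the correction divides the unnormalized product `w * q
  -- j` by `z`.
  log_eq : ∀ i, 0 < w i → Real.log (w i) + ∑ j, Real.log (q j i) = Real.log (b i)

theorem dykstraInv_init (hb : b ∈ stdSimplex ℝ (Fin N)) (hbpos : ∀ i, 0 < b i) :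
    DykstraInv C b b (fun _ _ => 1) fun _ => b where
  mem := hb
  mem_last _ := hb
  supp _ _ h := h
  pos _ _ _ := one_pos
  feas _ _ _ := suppLE_of_pos hbpos
  normal _ _ _ _ _ := by simp
  log_eq _ _ := by simp

/-- The value of the dual function. -/
noncomputable def dualValue (q p : Fin J → Fin N → ℝ) : ℝ :=
  ∑ j, ∑ i, -(p j i * Real.log (q j i))

theorem DykstraInv.pos_of_pos (h : DykstraInv C b w q p) (j : Fin J) {i : Fin N} (hi : 0 < w i) :
    0 < q j i :=
  h.pos j i ((h.supp j).pos (h.mem_last j).1 hi)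

theorem DykstraInv.normalizeVec_eq (h : DykstraInv C b w q p) (j : Fin J) :
    ∃ Z : ℝ, 0 < Z ∧ (∀ i, normalizeVec (w * q j) i = w i * q j i / Z) ∧
      (∀ i, 0 ≤ normalizeVec (w * q j) i) ∧ SuppLE w (normalizeVec (w * q j)) ∧
      SuppLE (normalizeVec (w * q j)) w := by
  have hnn : ∀ i, 0 ≤ w i * q j i := fun i => by
    rcases (h.mem.1 i).eq_or_lt with hi | hi
    · simp [← hi]
    · exact (mul_pos hi (h.pos_of_pos j hi)).le
  have hZ : 0 < ∑ l, w l * q j l := by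
    obtain ⟨i, hi⟩ : ∃ i, w i ≠ 0 := by
      by_contra! h0
      have := h.mem.2
      simp [h0] at this
    have hi : 0 < w i := lt_of_le_of_ne (h.mem.1 i) hi.symm
    exact Finset.sum_pos' (fun l _ => hnn l)
      ⟨i, Finset.mem_univ i, mul_pos hi (h.pos_of_pos j hi)⟩
  have he : ∀ i, normalizeVec (w * q j) i = w i * q j i / ∑ l, w l * q j l := fun i => rfl
  refine ⟨_, hZ, he, fun i => ?_, fun i hi => ?_, fun i hi => ?_⟩
  · rw [he]
    exact div_nonneg (hnn i) hZ.le
  · by_contra hwi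
    have hwi : 0 < w i := lt_of_le_of_ne (h.mem.1 i) (Ne.symm hwi)
    have := div_pos (mul_pos hwi (h.pos_of_pos j hwi)) hZ
    rw [he] at hi
    linarith
  · rw [he, hi]
    simp

theorem DykstraInv.suppLE_of_isKLProj (h : DykstraInv C b w q p) {j : Fin J}
    (hz : IsKLProj (C j) (normalizeVec (w * q j)) z) : SuppLE z w := by
  obtain ⟨Z, hZ, he, h0, h1, h2⟩ := h.normalizeVec_eq j
  exact (isKLProj_iff.1 hz).2.2.1.trans h2

theorem DykstraInv.step (h : DykstraInv C b w q p) {j : Fin J} (hC : Convex ℝ (C j))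
    (hz : IsKLProj (C j) (normalizeVec (w * q j)) z) :
    DykstraInv C b z (Function.update q j (w * q j / z)) (Function.update p j z) := by
  obtain ⟨Z, hZ, he, h0, h1, h2⟩ := h.normalizeVec_eq j
  obtain ⟨hzC, hzΔ, hzu, -⟩ := isKLProj_iff.1 hz
  have hzw : SuppLE z w := hzu.trans h2
  have hwpos : ∀ {i}, 0 < z i → 0 < w i := fun hi => hzw.pos h.mem.1 hi
  refine ⟨hzΔ, fun k => ?_, fun k => ?_, fun k i hi => ?_, fun v hv hvC => ?_, fun k => ?_,
    fun i hi => ?_⟩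
  · rcases eq_or_ne k j with rfl | hk
    · simpa using hzΔ
    · simpa [hk] using h.mem_last k
  · rcases eq_or_ne k j with rfl | hk
    · simp [SuppLE]
    · simpa [hk] using hzw.trans (h.supp k)
  · rcases eq_or_ne k j with rfl | hk
    · simp only [Function.update_self, Pi.div_apply, Pi.mul_apply] at hi ⊢
      exact div_pos (mul_pos (hwpos hi) (h.pos_of_pos k (hwpos hi))) hi
    · simp only [Function.update_of_ne hk] at hi ⊢
      exact h.pos k i hi
  · exact hz.suppLE hC h0 (hvC j) hv ((h.feas v hv hvC).trans h1)
  · rcases eq_or_ne k j with rfl | hk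
    · simp only [Function.update_self]
      intro v hvC hv hvz
      have hn := hz.sum_nonneg hC h0 hvC hv (hvz.trans hzu)
      -- The normalization contributes only the constant log Z, which cancels because `v` and `z`
      -- have equal mass; the rest is the variational inequality.
      have e : ∀ i, (v i - z i) * Real.log ((w * q k / z) i) =
          (v i - z i) * Real.log Z - (v i - z i) * Real.log (z i / normalizeVec (w * q k) i) := by
        intro i
        rcases (hzΔ.1 i).eq_or_lt with hi | hi
        · simp [← hi, hvz i hi.symm]
        have hw := hwpos hi
        have hq := h.pos_of_pos k hw
        have e1 : z i / normalizeVec (w * q k) i = Z / (w i * q k i / z i) := by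
          rw [he]
          field_simp
        rw [e1, Pi.div_apply, Pi.mul_apply, Real.log_div hZ.ne' (by positivity)]
        ring
      simp only [e, Finset.sum_sub_distrib, ← Finset.sum_mul, hv.2, hzΔ.2]
      linarith
    · simp only [Function.update_of_ne hk]
      exact h.normal k
  · have hw := hwpos hi
    have hq := h.pos_of_pos j hw
    rw [← h.log_eq i hw, ← Finset.add_sum_erase _ _ (Finset.mem_univ j),
      ← Finset.add_sum_erase _ _ (Finset.mem_univ j)]
    have e : ∑ x ∈ Finset.univ.erase j, Real.log (Function.update q j (w * q j / z) x i) =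
        ∑ x ∈ Finset.univ.erase j, Real.log (q x i) :=
      Finset.sum_congr rfl fun x hx => by rw [Function.update_of_ne (Finset.ne_of_mem_erase hx)]
    rw [e, Function.update_self, Pi.div_apply, Pi.mul_apply, Real.log_div (by positivity) hi.ne',
      Real.log_mul hw.ne' hq.ne']
    ring

theorem DykstraInv.exists_isKLProj (h : DykstraInv C b w q p) {j : Fin J} (hC : IsClosed (C j))
    (hfeas : ∃ v ∈ stdSimplex ℝ (Fin N), ∀ j, v ∈ C j) :
    ∃ z, IsKLProj (C j) (normalizeVec (w * q j)) z := by
  obtain ⟨v, hv, hvC⟩ := hfeas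
  obtain ⟨Z, hZ, he, h0, h1, h2⟩ := h.normalizeVec_eq j
  exact _root_.exists_isKLProj hC (hvC j) hv ((h.feas v hv hvC).trans h1)

theorem DykstraInv.isKLProj_unique (h : DykstraInv C b w q p) {j : Fin J} (hC : Convex ℝ (C j))
    {y : Fin N → ℝ} (hy : IsKLProj (C j) (normalizeVec (w * q j)) y)
    (hz : IsKLProj (C j) (normalizeVec (w * q j)) z) : y = z := by
  obtain ⟨Z, hZ, he, h0, h1, h2⟩ := h.normalizeVec_eq j
  exact hz.eq hC h0 hy

/-- This is `log_eq` paired with `v`. The last sum collects the normality slacks: nonnegative for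
feasible `v`, and the only obstacle to closing the gap. -/
theorem DykstraInv.klSum_eq (h : DykstraInv C b w q p) {v : Fin N → ℝ} (hvw : SuppLE v w)
    (hbpos : ∀ i, 0 < b i) :
    klSum v b = klSum v w + dualValue q p + ∑ j, ∑ i, (p j i - v i) * Real.log (q j i) := by
  have e : ∀ i, v i * Real.log (v i / b i) =
      v i * Real.log (v i / w i) + ∑ j, -(v i * Real.log (q j i)) := by
    intro i
    by_cases hv : v i = 0
    · simp [hv]
    have hw : w i ≠ 0 := fun h0 => hv (hvw i h0)
    rw [Real.log_div hv (hbpos i).ne', Real.log_div hv hw,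
      ← h.log_eq i (lt_of_le_of_ne (h.mem.1 i) hw.symm), Finset.sum_neg_distrib, ← Finset.mul_sum]
    ring
  rw [klSum, Finset.sum_congr rfl fun i _ => e i, Finset.sum_add_distrib, Finset.sum_comm,
    dualValue, add_assoc, ← Finset.sum_add_distrib, klSum]
  congr 1
  refine Finset.sum_congr rfl fun j _ => ?_
  rw [← Finset.sum_add_distrib]
  exact Finset.sum_congr rfl fun i _ => by ring

theorem DykstraInv.klSum_add_dualValue_le (h : DykstraInv C b w q p) (hbpos : ∀ i, 0 < b i)
    {v : Fin N → ℝ} (hv : v ∈ stdSimplex ℝ (Fin N)) (hvC : ∀ j, v ∈ C j) :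
    klSum v w + dualValue q p ≤ klSum v b := by
  have hvw := h.feas v hv hvC
  rw [h.klSum_eq hvw hbpos, le_add_iff_nonneg_right]
  refine Finset.sum_nonneg fun j _ => ?_
  have := h.normal j v (hvC j) hv (hvw.trans (h.supp j))
  rw [← neg_nonneg, ← Finset.sum_neg_distrib] at this
  exact this.trans_eq (Finset.sum_congr rfl fun i _ => by ring)

/-- Only block `j` changes. Its new value is KL(z‖w) - ∑ z log (q j), and the old normality at `p
j`, tested at `z`, allows replacing `z` by `p j` in that sum. -/
theorem DykstraInv.dualValue_add_le (h : DykstraInv C b w q p) {j : Fin J}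
    (hz : IsKLProj (C j) (normalizeVec (w * q j)) z) :
    dualValue q p + klSum z w ≤
      dualValue (Function.update q j (w * q j / z)) (Function.update p j z) := by
  have hzw := h.suppLE_of_isKLProj hz
  have hn := h.normal j z hz.1.1 hz.1.2 (hzw.trans (h.supp j))
  have e : ∑ i, -(z i * Real.log ((w * q j / z) i)) =
      klSum z w + ∑ i, -(z i * Real.log (q j i)) := by
    rw [klSum, ← Finset.sum_add_distrib]
    refine Finset.sum_congr rfl fun i _ => ?_
    rcases (hz.1.2.1 i).eq_or_lt with hi | hi
    · simp [← hi]
    have hw := hzw.pos h.mem.1 hi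
    have hq := h.pos_of_pos j hw
    rw [Pi.div_apply, Pi.mul_apply, Real.log_div (by positivity) hi.ne',
      Real.log_mul hw.ne' hq.ne', Real.log_div hi.ne' hw.ne']
    ring
  have e2 : ∑ x ∈ Finset.univ.erase j, ∑ i, -(Function.update p j z x i *
      Real.log (Function.update q j (w * q j / z) x i)) =
      ∑ x ∈ Finset.univ.erase j, ∑ i, -(p x i * Real.log (q x i)) :=
    Finset.sum_congr rfl fun x hx => by
      rw [Function.update_of_ne (Finset.ne_of_mem_erase hx),
        Function.update_of_ne (Finset.ne_of_mem_erase hx)]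
  rw [dualValue, dualValue, ← Finset.add_sum_erase _ _ (Finset.mem_univ j),
    ← Finset.add_sum_erase _ _ (Finset.mem_univ j), e2, Function.update_self,
    Function.update_self, e]
  simp only [sub_mul, Finset.sum_sub_distrib, Finset.sum_neg_distrib] at hn ⊢
  linarith

end Dykstra

theorem existsUnique_isBregmanDykstra {N J : ℕ} [NeZero J] {C : Fin J → Set (Fin N → ℝ)}
    {b : Fin N → ℝ} (hb : b ∈ stdSimplex ℝ (Fin N)) (hbpos : ∀ i, 0 < b i)
    (hcl : ∀ j, IsClosed (C j)) (hconv : ∀ j, Convex ℝ (C j))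
    (hfeas : ∃ v ∈ stdSimplex ℝ (Fin N), ∀ j, v ∈ C j) :
    ∃! wq : (ℕ → Fin N → ℝ) × (ℕ → Fin J → Fin N → ℝ), IsBregmanDykstra C b wq.1 wq.2 := by
  obtain ⟨f, ⟨hf0, hf⟩, huniq⟩ := existsUnique_seq
    -- The last projections `p` are not part of the state, so the invariant only asserts that some
    -- `p` exists.
    (α := (Fin N → ℝ) × (Fin J → Fin N → ℝ)) (fun _ x => ∃ p, DykstraInv C b x.1 x.2 p)
    (fun n x y => IsKLProj (C (Fin.ofNat J n)) (normalizeVec (x.1 * x.2 (Fin.ofNat J n))) y.1 ∧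
      y.2 = Function.update x.2 (Fin.ofNat J n) (x.1 * x.2 (Fin.ofNat J n) / y.1))
    (b, fun _ _ => 1) ⟨_, dykstraInv_init hb hbpos⟩
    (fun n x ⟨p, hp⟩ => by
      obtain ⟨z, hz⟩ := hp.exists_isKLProj (hcl (Fin.ofNat J n)) hfeas
      exact ⟨(z, Function.update x.2 (Fin.ofNat J n) (x.1 * x.2 (Fin.ofNat J n) / z)), hz, rfl⟩)
    (fun n x y z ⟨p, hp⟩ hy hz => by
      have h1 := hp.isKLProj_unique (hconv _) hy.1 hz.1
      exact Prod.ext h1 (by rw [hy.2, hz.2, h1]))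
    (fun n x y ⟨p, hp⟩ hy => ⟨_, hy.2 ▸ hp.step (hconv _) hy.1⟩)
  refine ⟨(fun n => (f n).1, fun n => (f n).2), ⟨by simp [hf0], by simp [hf0],
    fun n => (hf n).1, fun n => (hf n).2⟩, ?_⟩
  rintro ⟨w, q⟩ h
  have := huniq (fun n => (w n, q n))
    ⟨Prod.ext h.w_zero h.q_zero, fun n => ⟨h.w_succ n, h.q_succ n⟩⟩
  simp [← this]

/-! ### Estimates for the two constraint qualifications -/

/-- By Cauchy-Schwarz the square of the long sum is O(n + J). Were the product eventually at least
ε, the squared short sums, which are summable, would dominate a multiple of the harmonic series. -/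
theorem frequently_sum_mul_sum_lt {δ : ℕ → ℝ}
    (hs : Summable fun n => δ n ^ 2) (J : ℕ) {ε : ℝ} (hε : 0 < ε) :
    ∃ᶠ n in atTop,
      (∑ i ∈ Finset.range J, δ (n + i)) * ∑ m ∈ Finset.range (n + J), δ m < ε := by
  by_contra hcon
  rw [not_frequently] at hcon
  set S := ∑' n, δ n ^ 2 with hS
  have hS0 : 0 ≤ S := tsum_nonneg fun n => sq_nonneg _
  have hg : Summable fun n => (S + 1) / ε ^ 2 * (J * ∑ i ∈ Finset.range J, δ (n + i) ^ 2) :=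
    ((summable_sum fun i _ => (summable_nat_add_iff i).2 hs).mul_left _).mul_left _
  refine Real.not_summable_one_div_natCast ((summable_nat_add_iff J).1
    (hg.of_norm_bounded_eventually_nat ?_))
  filter_upwards [hcon, eventually_ge_atTop 1] with n hn hn1
  rw [not_lt] at hn
  have hpos : (0 : ℝ) < (n + J : ℕ) := by
    have : 0 < n + J := by omega
    exact_mod_cast this
  have hT : (∑ m ∈ Finset.range (n + J), δ m) ^ 2 ≤ (n + J : ℕ) * (S + 1) := by
    have h1 := sq_sum_le_card_mul_sum_sq (s := Finset.range (n + J)) (f := δ)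
    rw [Finset.card_range] at h1
    refine h1.trans (mul_le_mul_of_nonneg_left ?_ hpos.le)
    linarith [hs.sum_le_tsum (Finset.range (n + J)) fun i _ => sq_nonneg _]
  have hB : (∑ i ∈ Finset.range J, δ (n + i)) ^ 2 ≤ J * ∑ i ∈ Finset.range J, δ (n + i) ^ 2 := by
    simpa using sq_sum_le_card_mul_sum_sq (s := Finset.range J) (f := fun i => δ (n + i))
  have h2 : ε ^ 2 ≤ (J * ∑ i ∈ Finset.range J, δ (n + i) ^ 2) * ((n + J : ℕ) * (S + 1)) := by
    calc ε ^ 2 ≤ ((∑ i ∈ Finset.range J, δ (n + i)) * ∑ m ∈ Finset.range (n + J), δ m) ^ 2 := by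
          gcongr
      _ = (∑ i ∈ Finset.range J, δ (n + i)) ^ 2 * (∑ m ∈ Finset.range (n + J), δ m) ^ 2 :=
          mul_pow _ _ _
      _ ≤ _ := mul_le_mul hB hT (sq_nonneg _) ((sq_nonneg _).trans hB)
  rw [Real.norm_of_nonneg (by positivity), div_le_iff₀ hpos, div_mul_eq_mul_div, div_mul_eq_mul_div,
    le_div_iff₀ (by positivity), one_mul]
  linarith

theorem abs_log_sub_log_le {x y κ : ℝ} (hκ : 0 < κ) (hx : κ ≤ x) (hy : κ ≤ y) :
    |Real.log x - Real.log y| ≤ |x - y| / κ := by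
  have key : ∀ {x y : ℝ}, κ ≤ x → κ ≤ y → Real.log x - Real.log y ≤ |x - y| / κ := by
    intro x y hx hy
    have hx0 := hκ.trans_le hx
    have hy0 := hκ.trans_le hy
    rw [← Real.log_div hx0.ne' hy0.ne']
    calc Real.log (x / y) ≤ x / y - 1 := Real.log_le_sub_one_of_pos (by positivity)
      _ = (x - y) / y := by field_simp
      _ ≤ |x - y| / y := by gcongr; exact le_abs_self _
      _ ≤ |x - y| / κ := by gcongr
  refine abs_le.2 ⟨?_, key hx hy⟩
  have := key hy hx
  rw [abs_sub_comm] at this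
  linarith

/-- A bound on the divergence from a positive point bounds the entries away from zero. -/
theorem exists_pos_le_of_klSum_le {N : ℕ} {v : Fin N → ℝ} (hv : v ∈ stdSimplex ℝ (Fin N))
    (hvpos : ∀ i, 0 < v i) (B : ℝ) : ∃ κ > 0, ∀ w ∈ stdSimplex ℝ (Fin N), SuppLE v w →
      klSum v w ≤ B → ∀ i, κ ≤ w i := by
  -- The bound w i ≥ v i exp(-(B + 1) / v i) is v i log (v i / w i) ≤ B + 1 solved for `w i`. The
  -- extra 1 pays for isolating one term of the sum, whose terms are nonnegative only after adding w
  -- - v.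
  obtain ⟨κ, hκ, hle⟩ : ∃ κ > 0, ∀ i, κ ≤ v i * Real.exp (-((B + 1) / v i)) := by
    have hpos : ∀ i, 0 < v i * Real.exp (-((B + 1) / v i)) := fun i =>
      mul_pos (hvpos i) (Real.exp_pos _)
    rcases isEmpty_or_nonempty (Fin N) with h | h
    · exact ⟨1, one_pos, fun i => h.elim i⟩
    · obtain ⟨i, hi⟩ := Finite.exists_min fun i => v i * Real.exp (-((B + 1) / v i))
      exact ⟨_, hpos i, hi⟩
  refine ⟨κ, hκ, fun w hw hvw hB i => (hle i).trans ?_⟩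
  have hwpos : ∀ k, 0 < w k := fun k => hvw.pos hw.1 (hvpos k)
  have h1 : ∀ k, 0 ≤ v k * Real.log (v k / w k) - v k + w k := fun k => by
    have := sq_sub_le_mul_log (hv.1 k) (hw.1 k) (le_one_of_mem_stdSimplex hv k)
      (le_one_of_mem_stdSimplex hw k) (hvw k)
    nlinarith [sq_nonneg (v k - w k)]
  have h2 := Finset.single_le_sum (f := fun k => v k * Real.log (v k / w k) - v k + w k)
    (fun k _ => h1 k) (Finset.mem_univ i)
  simp only [Finset.sum_add_distrib, Finset.sum_sub_distrib, hv.2, hw.2] at h2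
  have h3 : v i * Real.log (v i / w i) ≤ B + 1 := by
    have := le_one_of_mem_stdSimplex hv i
    have : ∑ k, v k * Real.log (v k / w k) ≤ B := hB
    linarith [(hwpos i).le]
  have h4 : Real.log (v i / w i) ≤ (B + 1) / v i := by
    rw [le_div_iff₀ (hvpos i)]
    linarith
  have h5 : v i / w i ≤ Real.exp ((B + 1) / v i) :=
    (Real.log_le_iff_le_exp (div_pos (hvpos i) (hwpos i))).1 h4
  rw [Real.exp_neg, ← div_eq_mul_inv, div_le_iff₀ (Real.exp_pos _)]
  rw [div_le_iff₀ (hwpos i)] at h5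
  linarith

/-- Near `x`, a point of `C` can be pushed slightly away from `x` within `C`: an active half-space
constraint only gains slack, and an inactive one is strict near `x`. This supplies the hypothesis of
`IsNormalAt.sum_nonneg`. -/
theorem eventually_sub_smul_sub_mem {N : ℕ} {a : Fin N → ℝ} {τ : ℝ} {C : Set (Fin N → ℝ)}
    (hC : C = linHyperplane a τ ∨ C = linHalfspace a τ) {x : Fin N → ℝ} (hx : x ∈ C) :
    ∀ᶠ p in 𝓝 x, p ∈ C → ∀ᶠ ε : ℝ in 𝓝[>] 0, p - ε • (x - p) ∈ C := by
  rcases hC with rfl | rfl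
  · exact Eventually.of_forall fun p hp => Eventually.of_forall fun ε =>
      sub_smul_sub_mem_linHyperplane hp hx ε
  have hx : a ⬝ᵥ x ≤ τ := hx
  rcases hx.eq_or_lt with h | h
  · refine Eventually.of_forall fun p hp => ?_
    filter_upwards [self_mem_nhdsWithin] with ε hε
    have hε : 0 < ε := hε
    have hp : a ⬝ᵥ p ≤ τ := hp
    simp only [linHalfspace, Set.mem_ofPred_eq, dotProduct_sub, dotProduct_smul, smul_eq_mul, h]
    nlinarith
  · have hc : Continuous fun p => a ⬝ᵥ p := by unfold dotProduct; fun_prop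
    filter_upwards [hc.continuousAt.eventually (gt_mem_nhds h)] with p hp _
    have hc' : Continuous fun ε : ℝ => a ⬝ᵥ (p - ε • (x - p)) := hc.comp (by fun_prop)
    have hp : a ⬝ᵥ (p - (0 : ℝ) • (x - p)) < τ := by simpa using hp
    exact ((hc'.continuousAt.eventually (gt_mem_nhds hp)).filter_mono nhdsWithin_le_nhds).mono
      fun ε hε => hε.le

/-! ### Convergence of the Bregman-Dykstra scheme -/

section Convergence

variable {N J : ℕ} [NeZero J] {C : Fin J → Set (Fin N → ℝ)} {b : Fin N → ℝ} {w : ℕ → Fin N → ℝ}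
  {q : ℕ → Fin J → Fin N → ℝ}

/-- The last iterates before step `n` obtained by projection onto each of the sets. -/
def lastProj (J : ℕ) [NeZero J] (w : ℕ → Fin N → ℝ) : ℕ → Fin J → Fin N → ℝ
  -- A set not yet visited gets the starting point, which need not lie in it; this is harmless while
  -- its correction is 1.
  | 0 => fun _ => w 0
  | n + 1 => Function.update (lastProj J w n) (Fin.ofNat J n) (w (n + 1))

theorem IsBregmanDykstra.dykstraInv (h : IsBregmanDykstra C b w q)
    (hb : b ∈ stdSimplex ℝ (Fin N)) (hbpos : ∀ i, 0 < b i) (hconv : ∀ j, Convex ℝ (C j)) (n : ℕ) :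
    DykstraInv C b (w n) (q n) (lastProj J w n) := by
  induction n with
  | zero =>
    have := dykstraInv_init (C := C) hb hbpos
    simpa only [lastProj, h.w_zero, h.q_zero] using this
  | succ n ih =>
    rw [h.q_succ n]
    exact ih.step (hconv _) (h.w_succ n)

/-- The first alternative means that set `j` has not been visited; otherwise its last visit lies
within the previous `J` steps. -/
theorem lastProj_eq (w : ℕ → Fin N → ℝ) (n : ℕ) (j : Fin J) :
    n ≤ j ∨ ∃ m, m < n ∧ n ≤ m + J ∧ Fin.ofNat J m = j ∧ lastProj J w n j = w (m + 1) := by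
  induction n with
  | zero => exact Or.inl (Nat.zero_le _)
  | succ n ih =>
    rcases eq_or_ne (Fin.ofNat J n) j with hj | hj
    · exact Or.inr ⟨n, by omega, by have := Nat.pos_of_neZero J; omega, hj,
        by rw [lastProj, hj, Function.update_self]⟩
    rcases ih with h | ⟨m, h1, h2, h3, h4⟩
    · refine Or.inl (Nat.lt_of_le_of_ne h ?_)
      rintro rfl
      exact hj (by ext; simp)
    · refine Or.inr ⟨m, by omega, Nat.lt_of_le_of_ne h2 ?_, h3, ?_⟩
      · rintro rfl
        exact hj (by rw [← h3]; ext; simp)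
      · rw [lastProj, Function.update_of_ne hj.symm, h4]

theorem exists_lastProj_eq (w : ℕ → Fin N → ℝ) {n : ℕ} (hn : J ≤ n) (j : Fin J) :
    ∃ m, m < n ∧ n ≤ m + J ∧ Fin.ofNat J m = j ∧ lastProj J w n j = w (m + 1) :=
  (lastProj_eq w n j).resolve_left (by have := j.2; omega)

theorem dist_lastProj_le (w : ℕ → Fin N → ℝ) (n : ℕ) (j : Fin J) :
    dist (lastProj J w (n + J) j) (w (n + J)) ≤
      ∑ i ∈ Finset.range J, dist (w (n + i)) (w (n + i + 1)) := by
  obtain ⟨m, h1, h2, -, h4⟩ := exists_lastProj_eq w (Nat.le_add_left J n) j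
  rw [h4]
  refine (dist_le_Ico_sum_dist w h1).trans ?_
  have e := Finset.sum_Ico_add' (fun i => dist (w i) (w (i + 1))) 0 J n
  simp only [zero_add, Nat.Ico_zero_eq_range] at e
  simp only [add_comm n]
  rw [e]
  exact Finset.sum_le_sum_of_subset_of_nonneg (Finset.Ico_subset_Ico (by omega) (by omega))
    fun _ _ _ => dist_nonneg

theorem tendsto_dist_lastProj (hδ : Tendsto (fun n => dist (w n) (w (n + 1))) atTop (𝓝 0))
    (j : Fin J) : Tendsto (fun n => dist (lastProj J w n j) (w n)) atTop (𝓝 0) := by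
  rw [← tendsto_add_atTop_iff_nat J]
  refine squeeze_zero (fun _ => dist_nonneg) (fun n => dist_lastProj_le w n j) ?_
  have := tendsto_finsetSum (Finset.range J) (f := fun i n => dist (w (n + i)) (w (n + i + 1)))
    (a := fun _ => (0 : ℝ)) (x := atTop) fun i _ => hδ.comp (tendsto_add_atTop_nat i)
  simpa using this

/-- A visit changes log (q j) by log (w n) - log (w (n + 1)), and the logarithm is 1/κ-Lipschitz
above κ. -/
theorem IsBregmanDykstra.abs_log_le (h : IsBregmanDykstra C b w q)
    (hinv : ∀ n, DykstraInv C b (w n) (q n) (lastProj J w n)) {κ : ℝ} (hκ : 0 < κ)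
    (hw : ∀ n i, κ ≤ w n i) (n : ℕ) (j : Fin J) (i : Fin N) :
    |Real.log (q n j i)| ≤ (∑ m ∈ Finset.range n, dist (w m) (w (m + 1))) / κ := by
  induction n with
  | zero => simp [h.q_zero]
  | succ n ih =>
    rw [h.q_succ, Finset.sum_range_succ, add_div]
    rcases eq_or_ne j (Fin.ofNat J n) with rfl | hj
    · have h0 := hκ.trans_le (hw n i)
      have h1 := hκ.trans_le (hw (n + 1) i)
      have hq := (hinv n).pos_of_pos (Fin.ofNat J n) h0
      rw [Function.update_self, Pi.div_apply, Pi.mul_apply, Real.log_div (by positivity) h1.ne',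
        Real.log_mul h0.ne' hq.ne', add_sub_right_comm, add_comm]
      refine (abs_add_le _ _).trans (add_le_add ih ?_)
      refine (abs_log_sub_log_le hκ (hw _ i) (hw _ i)).trans ?_
      gcongr
      exact dist_le_pi_dist (w n) (w (n + 1)) i
    · rw [Function.update_of_ne hj]
      exact ih.trans (le_add_of_nonneg_right (by positivity))

theorem IsBregmanDykstra.tendsto (hb : b ∈ stdSimplex ℝ (Fin N)) (hbpos : ∀ i, 0 < b i)
    (hcl : ∀ j, IsClosed (C j)) (hconv : ∀ j, Convex ℝ (C j))
    (hqual : (∀ j, ∃ (a : Fin N → ℝ) (τ : ℝ), C j = linHyperplane a τ ∨ C j = linHalfspace a τ) ∨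
      (∃ v ∈ stdSimplex ℝ (Fin N), (∀ i, 0 < v i) ∧ ∀ j, v ∈ C j))
    {x : Fin N → ℝ} (hx : IsKLProj (⋂ j, C j) b x) (h : IsBregmanDykstra C b w q) :
    Tendsto w atTop (𝓝 x) := by
  have hinv := h.dykstraInv hb hbpos hconv
  set p := lastProj J w with hp
  set F : Set (Fin N → ℝ) := (⋂ j, C j) ∩ stdSimplex ℝ (Fin N) with hF
  have hFC : ∀ v ∈ F, ∀ j, v ∈ C j := fun v hv => Set.mem_iInter.1 hv.1
  set c : ℕ → ℝ := fun n => dualValue (q n) (p n) with hc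
  have hw : ∀ n, w n ∈ stdSimplex ℝ (Fin N) := fun n => (hinv n).mem
  have hsw : ∀ n, SuppLE (w (n + 1)) (w n) := fun n => (hinv n).suppLE_of_isKLProj (h.w_succ n)
  have hstep : ∀ n, c n + klSum (w (n + 1)) (w n) ≤ c (n + 1) := fun n => by
    have := (hinv n).dualValue_add_le (h.w_succ n)
    rw [← h.q_succ n] at this
    exact this
  have hmono : Monotone c := monotone_nat_of_le_succ fun n => by
    linarith [hstep n, klSum_nonneg (hw (n + 1)) (hw n) (hsw n)]
  have hs : ∀ v ∈ F, ∀ n, SuppLE v (w n) := fun v hv n => (hinv n).feas v hv.2 (hFC v hv)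
  have hdual : ∀ v ∈ F, ∀ n, klSum v (w n) + c n ≤ klSum v b := fun v hv n =>
    (hinv n).klSum_add_dualValue_le hbpos hv.2 (hFC v hv)
  have hsum := summable_dist_sq hw hsw hstep (B := klSum x b) fun n => by
    linarith [hdual x hx.1 n, klSum_nonneg hx.1.2 (hw n) (hs x hx.1 n)]
  have hδ := tendsto_dist_of_summable_sq hsum
  suffices hgap : ∃ y ∈ F, ∀ ε > 0, ∃ n, klSum y b ≤ c n + ε by
    obtain ⟨y, hyF, hy⟩ := hgap
    obtain ⟨h1, h2⟩ := tendsto_of_no_duality_gap Set.inter_subset_right hw hmono hs hdual hyF hy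
    have hy' : IsKLProj (⋂ j, C j) b y := isKLProj_iff.2 ⟨hyF.1, hyF.2, suppLE_of_pos hbpos,
      fun v hv hv' _ => h2 v ⟨hv, hv'⟩⟩
    rwa [hx.eq (convex_iInter hconv) hb.1 hy'] at h1
  have hcluster : ∀ {φ : ℕ → ℕ} {y : Fin N → ℝ}, Tendsto φ atTop atTop →
      Tendsto (fun k => w (φ k)) atTop (𝓝 y) → y ∈ ⋂ j, C j := fun hφ hy =>
    Set.mem_iInter.2 (mem_of_tendsto_of_cyclic hcl (fun n => (h.w_succ n).1.1) hδ hφ hy)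
  rcases hqual with hpoly | ⟨v, hv, hvpos, hvC⟩
  · obtain ⟨y, hyΔ, φ, hφ, hy⟩ := (isCompact_stdSimplex ℝ (Fin N)).tendsto_subseq hw
    have hyF : y ∈ F := ⟨hcluster hφ.tendsto_atTop hy, hyΔ⟩
    refine ⟨y, hyF, fun ε hε => ?_⟩
    -- The last projections also converge to `y`, so eventually the segments from `y` to them can be
    -- prolonged and the normality slacks at `y` are nonpositive.
    have hcomp : ∀ᶠ k in atTop, ∀ j, 0 ≤ ∑ i, (y i - p (φ k) j i) * Real.log (q (φ k) j i) := by
      refine eventually_all.2 fun j => ?_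
      obtain ⟨a, τ, hCj⟩ := hpoly j
      have hpy : Tendsto (fun k => p (φ k) j) atTop (𝓝 y) :=
        (tendsto_iff_of_dist ((tendsto_dist_lastProj hδ j).comp hφ.tendsto_atTop)).2 hy
      filter_upwards [hpy.eventually (eventually_sub_smul_sub_mem hCj (hFC y hyF j)),
        hφ.tendsto_atTop.eventually_ge_atTop J] with k hk hkJ
      obtain ⟨m, -, -, hm, hpm⟩ := exists_lastProj_eq w hkJ j
      have hpC : p (φ k) j ∈ C j := by
        rw [hp, hpm, ← hm]
        exact (h.w_succ m).1.1
      exact ((hinv (φ k)).normal j).sum_nonneg ((hinv (φ k)).mem_last j) hyΔ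
        ((hs y hyF _).trans ((hinv (φ k)).supp j)) (hk hpC)
    obtain ⟨k, hk1, hk2⟩ :=
      (hcomp.and ((tendsto_klSum_right hy).eventually (gt_mem_nhds hε))).exists
    have hk2 : klSum y (w (φ k)) < ε := hk2
    refine ⟨φ k, ?_⟩
    rw [(hinv (φ k)).klSum_eq (hs y hyF _) hbpos]
    have : ∑ j, ∑ i, (p (φ k) j i - y i) * Real.log (q (φ k) j i) ≤ 0 := by
      refine Finset.sum_nonpos fun j _ => ?_
      rw [← neg_nonneg, ← Finset.sum_neg_distrib]
      exact (hk1 j).trans_eq (Finset.sum_congr rfl fun i _ => by ring)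
    linarith
  · have hvF : v ∈ F := ⟨Set.mem_iInter.2 hvC, hv⟩
    have hc0 : c 0 = 0 := by simp [hc, dualValue, h.q_zero]
    obtain ⟨κ, hκ, hle⟩ := exists_pos_le_of_klSum_le hv hvpos (klSum v b)
    have hwκ : ∀ n i, κ ≤ w n i := fun n => hle _ (hw n) (hs v hvF n) (by
      linarith [hdual v hvF n, hmono (Nat.zero_le n)])
    set B : ℕ → ℝ := fun n => ∑ i ∈ Finset.range J, dist (w (n + i)) (w (n + i + 1)) with hB
    set T : ℕ → ℝ := fun n => ∑ m ∈ Finset.range n, dist (w m) (w (m + 1)) with hT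
    have hB0 : ∀ n, 0 ≤ B n := fun n => Finset.sum_nonneg fun _ _ => dist_nonneg
    -- The slack is evaluated at `w (n + J)` itself, which need not be feasible: each entry is a
    -- distance over the last `J` steps times a path length over κ.
    have hbound : ∀ n, klSum (w (n + J)) b ≤ c (n + J) + J * N / κ * (B n * T (n + J)) := by
      intro n
      rw [(hinv (n + J)).klSum_eq (fun _ hi => hi) hbpos, klSum_self, zero_add]
      gcongr
      calc ∑ j, ∑ i, (p (n + J) j i - w (n + J) i) * Real.log (q (n + J) j i)
          ≤ ∑ _j : Fin J, ∑ _i : Fin N, B n * (T (n + J) / κ) := by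
            refine Finset.sum_le_sum fun j _ => Finset.sum_le_sum fun i _ => ?_
            refine (le_abs_self _).trans ?_
            rw [abs_mul]
            exact mul_le_mul ((dist_le_pi_dist _ _ i).trans (dist_lastProj_le w n j))
              (h.abs_log_le hinv hκ hwκ _ j i) (abs_nonneg _) (hB0 n)
        _ = J * N / κ * (B n * T (n + J)) := by
            simp only [Finset.sum_const, Finset.card_univ, Fintype.card_fin, nsmul_eq_mul]
            ring
    -- The error bound need not tend to zero, so the subsequence is first chosen to make it small,
    -- and only then refined by compactness.
    obtain ⟨φ, hφ, hφB⟩ := extraction_forall_of_frequently fun k : ℕ =>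
      frequently_sum_mul_sum_lt hsum J (Nat.one_div_pos_of_nat (n := k) (α := ℝ))
    obtain ⟨y, hyΔ, ψ, hψ, hy⟩ := (isCompact_stdSimplex ℝ (Fin N)).tendsto_subseq
      (x := fun k => w (φ k + J)) fun k => hw _
    have hφψ : Tendsto (fun k => φ (ψ k) + J) atTop atTop :=
      (tendsto_add_atTop_nat J).comp (hφ.tendsto_atTop.comp hψ.tendsto_atTop)
    refine ⟨y, ⟨hcluster hφψ hy, hyΔ⟩, fun ε hε => ?_⟩
    have h1 : Tendsto (fun k => klSum (w (φ (ψ k) + J)) b) atTop (𝓝 (klSum y b)) :=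
      ((continuous_klSum b).tendsto y).comp hy
    have h2 : Tendsto (fun k => J * N / κ * (1 / ((ψ k : ℝ) + 1))) atTop (𝓝 0) := by
      have := (tendsto_one_div_add_atTop_nhds_zero_nat (𝕜 := ℝ)).comp hψ.tendsto_atTop
      simpa using this.const_mul (J * N / κ)
    obtain ⟨k, hk1, hk2⟩ :=
      ((h1.eventually (lt_mem_nhds (sub_lt_self (klSum y b) (half_pos hε)))).and
        (h2.eventually (gt_mem_nhds (half_pos hε)))).exists
    refine ⟨φ (ψ k) + J, ?_⟩
    have h3 : J * N / κ * (B (φ (ψ k)) * T (φ (ψ k) + J)) ≤ J * N / κ * (1 / ((ψ k : ℝ) + 1)) :=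
      mul_le_mul_of_nonneg_left (hφB (ψ k)).le (by positivity)
    linarith [hbound (φ (ψ k))]

end Convergence
theorem mainTheorem5 {N : ℕ} (b : Fin N → ℝ) (hb : b ∈ stdSimplex ℝ (Fin N))
    (hbpos : ∀ i, 0 < b i) :
    -- (i) cyclic one-dimensional KL projections over the equality constraints
    (∀ (K : ℕ) [NeZero K] (X : Matrix (Fin N) (Fin K) ℝ) (t : Fin K → ℝ),
      (∃ v ∈ stdSimplex ℝ (Fin N), X.transpose.mulVec v = t) →
      ∃ wstar : Fin N → ℝ,
        IsKLProj {v | X.transpose.mulVec v = t} b wstar ∧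
        (∀ v, IsKLProj {v | X.transpose.mulVec v = t} b v → v = wstar) ∧
        (∃! w : ℕ → Fin N → ℝ, IsCyclicKLProj X t b w) ∧
        (∀ w : ℕ → Fin N → ℝ, IsCyclicKLProj X t b w → Tendsto w atTop (𝓝 wstar)) ∧
        (∀ w : ℕ → Fin N → ℝ, IsCyclicTilt X t b w → Tendsto w atTop (𝓝 wstar))) ∧
    -- (ii) Bregman-Dykstra with the KL divergence
    (∀ (J : ℕ) [NeZero J] (C : Fin J → Set (Fin N → ℝ)),
      (∀ j, IsClosed (C j)) → (∀ j, Convex ℝ (C j)) →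
      (∃ v ∈ stdSimplex ℝ (Fin N), ∀ j, v ∈ C j) →
      ((∀ j, ∃ (a : Fin N → ℝ) (τ : ℝ), C j = linHyperplane a τ ∨ C j = linHalfspace a τ) ∨
        (∃ v ∈ stdSimplex ℝ (Fin N), (∀ i, 0 < v i) ∧ ∀ j, v ∈ C j)) →
      ∃ wstar : Fin N → ℝ,
        IsKLProj (⋂ j, C j) b wstar ∧
        (∀ v, IsKLProj (⋂ j, C j) b v → v = wstar) ∧
        (∃! wq : (ℕ → Fin N → ℝ) × (ℕ → Fin J → Fin N → ℝ), IsBregmanDykstra C b wq.1 wq.2) ∧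
        (∀ (w : ℕ → Fin N → ℝ) (q : ℕ → Fin J → Fin N → ℝ),
          IsBregmanDykstra C b w q → Tendsto w atTop (𝓝 wstar))) := by
  refine ⟨fun K _ X t hfeas => ?_, fun J _ C hcl hconv hfeas hqual => ?_⟩
  · obtain ⟨v, hv, hvt⟩ := hfeas
    have hcl : IsClosed {v | X.transpose.mulVec v = t} := by
      rw [setOf_mulVec_eq]
      exact isClosed_iInter fun k => isClosed_linHyperplane _ _
    have hconv : Convex ℝ {v | X.transpose.mulVec v = t} := by
      rw [setOf_mulVec_eq]
      exact convex_iInter fun k => convex_linHyperplane _ _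
    obtain ⟨x, hx⟩ := exists_isKLProj hcl hvt hv (suppLE_of_pos hbpos)
    exact ⟨x, hx, fun y hy => hx.eq hconv hb.1 hy,
      existsUnique_isCyclicKLProj hb hbpos ⟨v, hv, hvt⟩,
      fun w hw => hw.tendsto hb hbpos hx,
      fun w hw => (hw.isCyclicKLProj hb).tendsto hb hbpos hx⟩
  · obtain ⟨v, hv, hvC⟩ := hfeas
    obtain ⟨x, hx⟩ := exists_isKLProj (isClosed_iInter hcl) (Set.mem_iInter.2 hvC) hv
      (suppLE_of_pos hbpos)
    exact ⟨x, hx, fun y hy => hx.eq (convex_iInter hconv) hb.1 hy,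
      existsUnique_isBregmanDykstra hb hbpos hcl hconv ⟨v, hv, hvC⟩,
      fun w q h => h.tendsto hb hbpos hcl hconv hqual hx⟩
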